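/- Let $K\ge 1$, let $p$ be the transition matrix of an irreducible aperiodic Markov chain on $\{1,\dots,K\}$ with equilibrium distribution $\pi$, and let $\alpha_1,\dots,\alpha_K>0$ with $\sum_k\alpha_k=1$ and $\lambda>0$. For every $n\ge K$ let $\mathcal V=\{1,\dots,n\}$ be partitioned into nonempty clusters $\mathcal V_1,\dots,\mathcal V_K$ (depending on $n$) with $\#\mathcal V_k=\alpha_k n+o(n)$ for each $k$, write $\sigma(v)=k$ for $v\in\mathcal V_k$, and let $X=(X_0,\dots,X_\ell)$, with $\ell=\ell_n=\lambda n^2+o(n^2)$, be a sample path of the block Markov chain on $\mathcal V$, that is, of the Markov chain with transition probabilities $P_{x,y}=p_{\sigma(x),\sigma(y)}/\#\mathcal V_{\sigma(y)}$, started in its equilibrium distribution. For a directed edge $e=(i,j)\in\mathcal V^2$ put $N_{X,e}=\#\{0\le t<\ell: X_t=i,\ X_{t+1}=j\}$, and for $k_1,k_2\in\{1,\dots,K\}$ put $r_{k_1k_2}=\lambda\,\pi(k_1)\,\alpha_{k_1}^{-1}\alpha_{k_2}^{-1}\,p_{k_1k_2}$. (a) Let $k_1,k_2$ satisfy $p_{k_1k_2}>0$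 and let $e_n\in\mathcal V_{k_1}\times\mathcal V_{k_2}$ for every $n\ge K$ (self-loops are allowed). Then, as $n\to\infty$, $\operatorname{Var}[N_{X,e_n}]=r_{k_1k_2}+o(1)$, and for every integer $m\ge 0$, $\mathbb E[N_{X,e_n}^m]=\mathbb E[Y^m]+o(1)$, where $Y$ has the Poisson distribution with rate $r_{k_1k_2}$. (b) Consequently the variance profile of $(N_{X,ij})_{i,j}$ is asymptotically block constant: $$\max_{1\le i,j\le n}\bigl|\operatorname{Var}[N_{X,ij}]-r_{\sigma(i)\sigma(j)}\bigr|\longrightarrow 0\qquad(n\to\infty).$$ -/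

import Mathlib

open MeasureTheory ProbabilityTheory Filter Asymptotics

namespace BlockMarkov

/-- Every state has period one: the only common divisor of its possible return times is `1`. -/
def IsAperiodic {S : Type*} [Fintype S] [DecidableEq S] (P : Matrix S S ℝ) : Prop :=
  ∀ (i : S) (d : ℕ), (∀ t : ℕ, 0 < t → 0 < (P ^ t) i i → d ∣ t) → d = 1

/-- `ι` is a probability vector which is stationary for the transition matrix `P`. -/
structure IsEquilibrium {S : Type*} [Fintype S] (P : Matrix S S ℝ) (ι : S → ℝ) : Prop where
  nonneg : ∀ x, 0 ≤ ι x
  sum_eq_one : ∑ x, ι x = 1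
  stationary : Matrix.vecMul ι P = ι

/-- `X 0, …, X ℓ` is, under `μ`, a sample path of length `ℓ` of the Markov chain with transition
matrix `P` and initial distribution `ι`. The random variables `X t` with `t > ℓ` play no role. -/
structure IsSamplePath {Ω S : Type*} [MeasurableSpace Ω] [MeasurableSpace S]
    (μ : Measure Ω) (X : ℕ → Ω → S) (ℓ : ℕ) (ι : S → ℝ) (P : Matrix S S ℝ) : Prop where
  measurable : ∀ t ≤ ℓ, Measurable (X t)
  initial : ∀ v, μ.real {ω | X 0 ω = v} = ι v
  step : ∀ t < ℓ, ∀ x : ℕ → S,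
    μ.real {ω | ∀ s ≤ t + 1, X s ω = x s} =
      μ.real {ω | ∀ s ≤ t, X s ω = x s} * P (x t) (x (t + 1))

/-- The number of states in the cluster `k`, that is, of the `v` with `σ v = k`. -/
def clusterSize {V C : Type*} [Fintype V] [DecidableEq C] (σ : V → C) (k : C) : ℕ :=
  (Finset.univ.filter fun v => σ v = k).card

/-- The transition matrix of the block Markov chain with cluster transition matrix `p` and
cluster map `σ`. -/
noncomputable def blockTransition {V C : Type*} [Fintype V] [DecidableEq C]
    (p : Matrix C C ℝ) (σ : V → C) : Matrix V V ℝ :=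
  Matrix.of fun x y => p (σ x) (σ y) / (clusterSize σ (σ y) : ℝ)

/-- The number of traversals of the directed edge from `i` to `j` by the path `X 0, …, X ℓ`. -/
noncomputable def edgeCount {Ω V : Type*} [DecidableEq V] (X : ℕ → Ω → V) (ℓ : ℕ) (i j : V) :
    Ω → ℝ :=
  fun ω => ∑ t ∈ Finset.range ℓ, if X t ω = i ∧ X (t + 1) ω = j then (1 : ℝ) else 0

/-- The limiting rate `lam * π(k₁) * α_{k₁}⁻¹ * α_{k₂}⁻¹ * p_{k₁ k₂}` of the block `(k₁, k₂)`. -/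
noncomputable def blockRate {C : Type*} (lam : ℝ) (π α : C → ℝ) (p : Matrix C C ℝ)
    (k₁ k₂ : C) : ℝ :=
  lam * π k₁ * (α k₁)⁻¹ * (α k₂)⁻¹ * p k₁ k₂

end BlockMarkov

namespace BlockMarkov

/-! The proof is the method of factorial moments. Write `q = ι i * P i j` for the probability that a
given step traverses the edge. By the Markov property, the expected number of `(m+1)`-sets of
traversal times is a sum over `t₀ < ⋯ < tₘ` of `q` times a product of return kernels `c g = (P ^ g)
j i * P i j`, one for each gap (`traversalMoment_succ`, `integral_choose_traversals`).

If every `c g` were equal to `q`, the `k`-th factorial moment would be `q ^ k` times the falling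
factorial of `ℓ`. Since `q` is of order at most `n⁻²` and `q * ℓ → r`, this tends to `r ^ k`, the
factorial moment of the Poisson law. The error is controlled by the `ℓ¹` distance of `c` from `q` on
gaps below `ℓ` (`abs_iterate_sub_le`). For `g ≥ 1` powers of the block matrix are powers of `p`
divided by a cluster size, so mixing of the fixed chain `p` and Cesàro averaging give `O(n⁻²) *
o(ℓ)`; the gap `g = 0` costs `O(n⁻¹)` (`tendsto_sum_abs_kernel_sub`).

Factorial moments determine ordinary moments, and the first two give the variance. Uniformity over
edges follows by applying the limit to a worst edge in each of the finitely many blocks. -/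

/-! ### Mixing of finite chains -/

/-- An irreducible aperiodic nonnegative matrix is primitive. -/
theorem isPrimitive_of_isAperiodic {S : Type*} [Fintype S] [DecidableEq S]
    {P : Matrix S S ℝ} (hirr : P.IsIrreducible) (haper : IsAperiodic P) : P.IsPrimitive := by
  have hpow : ∀ t i j, 0 ≤ (P ^ t) i j := by
    intro t
    induction t with
    | zero => intro i j; by_cases h : i = j <;> simp [h]
    | succ t ih =>
      intro i j
      rw [pow_succ, Matrix.mul_apply]
      exact Finset.sum_nonneg fun k _ => mul_nonneg (ih i k) (hirr.nonneg k j)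
  have hmul : ∀ s t i j k, 0 < (P ^ s) i j → 0 < (P ^ t) j k → 0 < (P ^ (s + t)) i k := by
    intro s t i j k h₁ h₂
    rw [pow_add, Matrix.mul_apply]
    exact (mul_pos h₁ h₂).trans_le (Finset.single_le_sum
      (f := fun l => (P ^ s) i l * (P ^ t) l k)
      (fun l _ => mul_nonneg (hpow s i l) (hpow t l k)) (Finset.mem_univ j))
  have hdiag : ∀ i, ∃ N, ∀ t ≥ N, 0 < (P ^ t) i i := by
    intro i
    let s : Set ℕ := {t | 0 < t ∧ 0 < (P ^ t) i i}
    -- Return times are closed under addition, and a numerical semigroup with gcd one contains all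
    -- large integers.
    have hs : Nat.setGcd s = 1 :=
      haper i _ fun t ht h => Nat.setGcd_dvd_of_mem (show t ∈ s from ⟨ht, h⟩)
    obtain ⟨N, hN⟩ := Nat.exists_mem_closure_of_ge s
    refine ⟨N, fun t ht => ?_⟩
    have hmem := hN t ht (by rw [hs]; exact one_dvd t)
    clear ht
    induction hmem using AddSubmonoid.closure_induction with
    | mem x hx => exact hx.2
    | zero => simp
    | add x y _ _ hx hy => exact hmul _ _ _ _ _ hx hy
  have hirr' := (Matrix.isIrreducible_iff_exists_pow_pos hirr.nonneg).1 hirr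
  choose N hN using hdiag
  choose s _ hs using hirr'
  -- One exponent for all pairs: it exceeds each `N i + s i j`, so the surplus can be spent on a
  -- loop at `i` before going to `j`.
  refine ⟨hirr.nonneg, (∑ i, N i) + (∑ i, ∑ j, s i j) + 1, by omega, fun i j => ?_⟩
  have h₁ : N i ≤ ∑ i, N i := Finset.single_le_sum (fun _ _ => Nat.zero_le _) (Finset.mem_univ i)
  have h₂ : s i j ≤ ∑ i, ∑ j, s i j :=
    (Finset.single_le_sum (f := fun j => s i j) (fun _ _ => Nat.zero_le _)
      (Finset.mem_univ j)).trans
      (Finset.single_le_sum (f := fun i => ∑ j, s i j) (fun _ _ => Nat.zero_le _)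
        (Finset.mem_univ i))
  obtain ⟨u, hu⟩ : ∃ u, (∑ i, N i) + (∑ i, ∑ j, s i j) + 1 = u + s i j :=
    ⟨(∑ i, N i) + (∑ i, ∑ j, s i j) + 1 - s i j, by omega⟩
  rw [hu]
  exact hmul _ _ _ _ _ (hN i u (by omega)) (hs i j)

theorem IsEquilibrium.vecMul_pow {S : Type*} [Fintype S] [DecidableEq S] {P : Matrix S S ℝ}
    {ι : S → ℝ} (h : IsEquilibrium P ι) (t : ℕ) : Matrix.vecMul ι (P ^ t) = ι := by
  induction t with
  | zero => simp
  | succ t ih => rw [pow_succ, ← Matrix.vecMul_vecMul, ih, h.stationary]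

theorem IsEquilibrium.sum_mul_pow {S : Type*} [Fintype S] [DecidableEq S] {P : Matrix S S ℝ}
    {ι : S → ℝ} (h : IsEquilibrium P ι) (t : ℕ) (y : S) : ∑ x, ι x * (P ^ t) x y = ι y := by
  have := congrFun (h.vecMul_pow t) y
  simpa [Matrix.vecMul, dotProduct] using this

theorem IsEquilibrium.le_one {S : Type*} [Fintype S] {P : Matrix S S ℝ} {ι : S → ℝ}
    (h : IsEquilibrium P ι) (x : S) : ι x ≤ 1 := by
  rw [← h.sum_eq_one]
  exact Finset.single_le_sum (fun y _ => h.nonneg y) (Finset.mem_univ x)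

/-- Convergence to equilibrium of a primitive stochastic matrix. -/
theorem tendsto_pow_of_isPrimitive {S : Type*} [Fintype S] [DecidableEq S] {P : Matrix S S ℝ}
    (hP : P ∈ Matrix.rowStochastic ℝ S) (hprim : P.IsPrimitive) {ι : S → ℝ}
    (hι : IsEquilibrium P ι) (i j : S) : Tendsto (fun t => (P ^ t) i j) atTop (nhds (ι j)) := by
  have : Nonempty S := ⟨i⟩
  obtain ⟨N, hN, hpos⟩ := hprim.exists_pos_pow
  obtain ⟨a, ha⟩ := Finite.exists_min fun x : S × S => (P ^ N) x.1 x.2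
  set ε := (P ^ N) a.1 a.2 with hε
  have hε0 : 0 < ε := hpos _ _
  have hrow : ∀ t i, ∑ k, (P ^ t) i k = 1 := fun t i =>
    Matrix.sum_row_of_mem_rowStochastic (pow_mem hP t) i
  let D : ℕ → S → S → ℝ := fun t i j => (P ^ t) i j - ι j
  have hD0 : ∀ t j, ∑ k, ι k * D t k j = 0 := by
    intro t j
    simp only [D, mul_sub, Finset.sum_sub_distrib, hι.sum_mul_pow, ← Finset.sum_mul,
      hι.sum_eq_one, one_mul, sub_self]
  have hDadd : ∀ s t i j, D (s + t) i j = ∑ k, (P ^ s) i k * D t k j := by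
    intro s t i j
    simp only [D, mul_sub, Finset.sum_sub_distrib, ← Finset.sum_mul, hrow, one_mul, pow_add,
      Matrix.mul_apply]
  -- Doeblin minorization: by `hD0`, subtracting `c * ι k` from the weights changes nothing, and
  -- what remains is nonnegative of total mass `1 - c`.
  have hcontr : ∀ s c, 0 ≤ c → (∀ i k, c * ι k ≤ (P ^ s) i k) →
      ∀ t, ‖D (s + t)‖ ≤ (1 - c) * ‖D t‖ := by
    intro s c hc hle t
    have hc1 : 0 ≤ 1 - c := by
      have := Finset.sum_le_sum fun k (_ : k ∈ Finset.univ) => hle i k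
      rw [← Finset.mul_sum, hι.sum_eq_one, hrow] at this
      linarith
    have hb : 0 ≤ (1 - c) * ‖D t‖ := mul_nonneg hc1 (norm_nonneg _)
    refine (pi_norm_le_iff_of_nonneg hb).2 fun x => (pi_norm_le_iff_of_nonneg hb).2 fun y => ?_
    have : D (s + t) x y = ∑ k, ((P ^ s) x k - c * ι k) * D t k y := by
      simp only [sub_mul, Finset.sum_sub_distrib, mul_assoc, ← Finset.mul_sum, hD0, mul_zero,
        sub_zero, hDadd]
    rw [this]
    calc ‖∑ k, ((P ^ s) x k - c * ι k) * D t k y‖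
        ≤ ∑ k, ((P ^ s) x k - c * ι k) * ‖D t‖ := by
          refine (norm_sum_le _ _).trans (Finset.sum_le_sum fun k _ => ?_)
          rw [norm_mul, Real.norm_of_nonneg (sub_nonneg.2 (hle x k))]
          exact mul_le_mul_of_nonneg_left ((norm_le_pi_norm (D t k) y).trans
            (norm_le_pi_norm (D t) k)) (sub_nonneg.2 (hle x k))
      _ = (1 - c) * ‖D t‖ := by
          rw [← Finset.sum_mul, Finset.sum_sub_distrib, hrow, ← Finset.mul_sum, hι.sum_eq_one,
            mul_one]
  have hanti : Antitone fun t => ‖D t‖ := by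
    refine antitone_nat_of_succ_le fun t => ?_
    have := hcontr 1 0 le_rfl (fun i k => by
      rw [zero_mul]; exact Matrix.nonneg_of_mem_rowStochastic (pow_mem hP 1)) t
    rw [add_comm t 1]
    linarith
  have hN' : ∀ t, ‖D (N + t)‖ ≤ (1 - ε) * ‖D t‖ := hcontr N ε hε0.le fun i k =>
    (mul_le_of_le_one_right hε0.le (hι.le_one k)).trans (ha (i, k))
  -- The decreasing norms have a limit `L`; the contraction along `N`-step jumps gives `L ≤ (1 - ε)
  -- * L`, hence `L = 0`.
  have hlim := tendsto_atTop_ciInf hanti ⟨0, by rintro _ ⟨t, rfl⟩; exact norm_nonneg _⟩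
  set L := ⨅ t, ‖D t‖
  have hL0 : 0 ≤ L := ge_of_tendsto' hlim fun t => norm_nonneg _
  have hL : L ≤ (1 - ε) * L :=
    le_of_tendsto_of_tendsto' (hlim.comp (tendsto_add_atTop_nat N)) (hlim.const_mul (1 - ε))
      fun t => by simpa [add_comm] using hN' t
  have hLz : L = 0 := by nlinarith
  rw [hLz] at hlim
  have := squeeze_zero_norm (f := fun t => D t i j) (fun t =>
    (norm_le_pi_norm (D t i) j).trans (norm_le_pi_norm (D t) i)) hlim
  exact tendsto_sub_nhds_zero_iff.1 this

/-! ### Reduction of the block chain to the cluster chain -/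

section Block

variable {V C : Type*} [Fintype V] [DecidableEq C] {σ : V → C}

theorem clusterSize_pos (hσ : Function.Surjective σ) (k : C) : 0 < clusterSize σ k := by
  obtain ⟨v, hv⟩ := hσ k
  exact Finset.card_pos.2 ⟨v, by simp [hv]⟩

variable [Fintype C]

theorem sum_div_clusterSize (hσ : Function.Surjective σ) (f : C → ℝ) :
    ∑ v, f (σ v) / (clusterSize σ (σ v) : ℝ) = ∑ k, f k := by
  rw [← Finset.sum_fiberwise Finset.univ σ]
  refine Finset.sum_congr rfl fun k _ => ?_
  have hk : (clusterSize σ k : ℝ) ≠ 0 := by exact_mod_cast (clusterSize_pos hσ k).ne'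
  rw [Finset.sum_congr rfl (g := fun _ => f k / (clusterSize σ k : ℝ))
    (fun v hv => by rw [(Finset.mem_filter.1 hv).2]), Finset.sum_const, nsmul_eq_mul]
  change (clusterSize σ k : ℝ) * _ = _
  field_simp

/-- Each step lands uniformly in its target cluster, so summing over intermediate vertices cancels
the cluster sizes. The power zero is excluded: the identity is not spread over a cluster. -/
theorem blockTransition_pow [DecidableEq V] (hσ : Function.Surjective σ) (p : Matrix C C ℝ)
    (t : ℕ) (x y : V) : (blockTransition p σ ^ (t + 1)) x y =
      (p ^ (t + 1)) (σ x) (σ y) / (clusterSize σ (σ y) : ℝ) := by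
  induction t generalizing y with
  | zero => simp [blockTransition]
  | succ t ih =>
    rw [pow_succ, Matrix.mul_apply, pow_succ p (t + 1), Matrix.mul_apply, Finset.sum_div,
      ← sum_div_clusterSize hσ]
    refine Finset.sum_congr rfl fun z _ => ?_
    rw [ih]
    simp only [blockTransition, Matrix.of_apply]
    ring

/-- The equilibrium of the block chain is uniform on each cluster. -/
theorem equilibrium_blockTransition_apply [DecidableEq V] (hσ : Function.Surjective σ)
    {p : Matrix C C ℝ} (hp : p ∈ Matrix.rowStochastic ℝ C) (hprim : p.IsPrimitive) {π : C → ℝ}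
    (hπ : IsEquilibrium p π) {ι : V → ℝ} (hι : IsEquilibrium (blockTransition p σ) ι) (v : V) :
    ι v = π (σ v) / (clusterSize σ (σ v) : ℝ) := by
  -- The cluster masses of `ι`. They are stationary for `p`, hence equal to `π` by convergence to
  -- equilibrium.
  let ν : C → ℝ := fun k => ∑ u with σ u = k, ι u
  have hν : ∀ f : C → ℝ, ∑ u, ι u * f (σ u) = ∑ k, ν k * f k := by
    intro f
    rw [← Finset.sum_fiberwise Finset.univ σ]
    refine Finset.sum_congr rfl fun k _ => ?_
    rw [Finset.sum_mul]
    exact Finset.sum_congr rfl fun u hu => by rw [(Finset.mem_filter.1 hu).2]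
  have hv : ∀ v, ι v = (∑ k, ν k * p k (σ v)) / (clusterSize σ (σ v) : ℝ) := by
    intro v
    conv_lhs => rw [← hι.sum_mul_pow 1 v]
    rw [← hν, Finset.sum_div]
    exact Finset.sum_congr rfl fun u _ => by simp [blockTransition, mul_div_assoc]
  have hνeq : IsEquilibrium p ν := by
    refine ⟨fun k => Finset.sum_nonneg fun u _ => hι.nonneg u, ?_, ?_⟩
    · rw [← hι.sum_eq_one]
      exact Finset.sum_fiberwise Finset.univ σ ι
    · funext k
      have hk : (clusterSize σ k : ℝ) ≠ 0 := by exact_mod_cast (clusterSize_pos hσ k).ne'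
      change ∑ l, ν l * p l k = ∑ u with σ u = k, ι u
      have : ∑ u with σ u = k, ι u =
          ∑ u with σ u = k, (∑ l, ν l * p l k) / (clusterSize σ k : ℝ) :=
        Finset.sum_congr rfl fun u hu => by rw [hv, (Finset.mem_filter.1 hu).2]
      rw [this, Finset.sum_const, nsmul_eq_mul]
      change _ = (clusterSize σ k : ℝ) * _
      field_simp
  have : ν = π := by
    funext k
    refine tendsto_nhds_unique (f := fun t : ℕ => ∑ l, ν l * (p ^ t) l k) (l := atTop) ?_ ?_
    · simp only [hνeq.sum_mul_pow, tendsto_const_nhds]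
    · have := tendsto_finsetSum Finset.univ fun l (_ : l ∈ Finset.univ) =>
        (tendsto_pow_of_isPrimitive hp hprim hπ l k).const_mul (ν l)
      rwa [← Finset.sum_mul, hνeq.sum_eq_one, one_mul] at this
  rw [hv, this]
  congr 1
  simpa using hπ.sum_mul_pow 1 (σ v)

end Block
end BlockMarkov

/-! ### Factorial moments and the Poisson law -/

namespace BlockMarkov

/-- Write one factor `N` as `(N - k) + k`. This trades a power for a longer falling factorial, which
drives the inductions on moments. -/
theorem pow_succ_mul_descFactorial (N m k : ℕ) :
    (N : ℝ) ^ (m + 1) * N.descFactorial k =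
      (N : ℝ) ^ m * N.descFactorial (k + 1) + k * ((N : ℝ) ^ m * N.descFactorial k) := by
  rcases le_or_gt k N with h | h
  · rw [Nat.descFactorial_succ]
    push_cast [h]
    ring
  · simp [Nat.descFactorial_of_lt h]

theorem hasSum_poisson_descFactorial (r : NNReal) (k : ℕ) :
    HasSum (fun n : ℕ => (Real.exp (-r) * r ^ n / (n.factorial : ℝ)) * (n.descFactorial k : ℝ))
      ((r : ℝ) ^ k) := by
  -- Terms below `k` vanish; after the shift the falling factorial cancels against the factorial and
  -- leaves the Poisson mass.
  rw [← hasSum_nat_add_iff' k]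
  rw [Finset.sum_eq_zero fun i hi => by
    rw [Nat.descFactorial_of_lt (Finset.mem_range.1 hi)]; simp, sub_zero]
  have := (hasSum_one_poissonMeasure r).mul_left ((r : ℝ) ^ k)
  rw [mul_one] at this
  refine this.congr_fun fun n => ?_
  have hf := Nat.factorial_mul_descFactorial (Nat.le_add_left k n)
  rw [Nat.add_sub_cancel] at hf
  have hn : (n.factorial : ℝ) ≠ 0 := by exact_mod_cast n.factorial_ne_zero
  have hd : ((n + k).descFactorial k : ℝ) ≠ 0 := by
    exact_mod_cast (Nat.descFactorial_pos.2 (Nat.le_add_left k n)).ne'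
  rw [← hf]
  push_cast
  field_simp
  ring

theorem integrable_poisson_pow_mul_descFactorial (r : NNReal) (m k : ℕ) :
    Integrable (fun n : ℕ => (n : ℝ) ^ m * (n.descFactorial k : ℝ)) (poissonMeasure r) := by
  induction m generalizing k with
  | zero =>
    rw [integrable_poissonMeasure_iff]
    simpa [abs_of_nonneg] using (hasSum_poisson_descFactorial r k).summable
  | succ m ih =>
    simp only [pow_succ_mul_descFactorial]
    exact (ih (k + 1)).add ((ih k).const_mul _)

theorem integral_poisson_descFactorial (r : NNReal) (k : ℕ) :
    ∫ n : ℕ, (n.descFactorial k : ℝ) ∂(poissonMeasure r) = (r : ℝ) ^ k := by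
  rw [integral_poissonMeasure]
  exact (hasSum_poisson_descFactorial r k).tsum_eq

/-- Convergence of all factorial moments to those of a Poisson law implies convergence of all
moments. -/
theorem tendsto_moment_of_tendsto_descFactorial {I : Type*} {l : Filter I} {Ω : I → Type*}
    [∀ n, MeasurableSpace (Ω n)] (μ : ∀ n, Measure (Ω n)) (N : ∀ n, Ω n → ℕ) (r : NNReal)
    (hint : ∀ n (f : ℕ → ℝ), Integrable (fun ω => f (N n ω)) (μ n))
    (h : ∀ k, Tendsto (fun n => ∫ ω, ((N n ω).descFactorial k : ℝ) ∂(μ n)) l (nhds ((r : ℝ) ^ k)))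
    (m : ℕ) : Tendsto (fun n => ∫ ω, (N n ω : ℝ) ^ m ∂(μ n)) l
      (nhds (∫ y : ℕ, (y : ℝ) ^ m ∂(poissonMeasure r))) := by
  -- The extra falling factorial makes the statement inductive: raising `m` calls on both `k` and `k
  -- + 1`.
  have key : ∀ m k, Tendsto (fun n => ∫ ω, (N n ω : ℝ) ^ m * ((N n ω).descFactorial k : ℝ) ∂(μ n)) l
      (nhds (∫ y : ℕ, (y : ℝ) ^ m * (y.descFactorial k : ℝ) ∂(poissonMeasure r))) := by
    intro m
    induction m with
    | zero => intro k; simpa [integral_poisson_descFactorial] using h k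
    | succ m ih =>
      intro k
      simp only [pow_succ_mul_descFactorial]
      rw [integral_add (integrable_poisson_pow_mul_descFactorial r m (k + 1))
        ((integrable_poisson_pow_mul_descFactorial r m k).const_mul _), integral_const_mul]
      refine ((ih (k + 1)).add ((ih k).const_mul (k : ℝ))).congr fun n => ?_
      rw [integral_add (hint n fun x => (x : ℝ) ^ m * (x.descFactorial (k + 1) : ℝ))
        (hint n fun x => k * ((x : ℝ) ^ m * (x.descFactorial k : ℝ))), integral_const_mul]
  simpa using key m 0

theorem integral_poisson_sq (r : NNReal) :
    ∫ y : ℕ, (y : ℝ) ^ 2 ∂(poissonMeasure r) = (r : ℝ) ^ 2 + r := by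
  have h : ∀ y : ℕ, (y : ℝ) ^ 2 = (y.descFactorial 2 : ℝ) + (y.descFactorial 1 : ℝ) := fun y => by
    have := pow_succ_mul_descFactorial y 0 1
    simp only [Nat.descFactorial_one] at this ⊢
    push_cast at this
    linarith
  have hi : ∀ k, Integrable (fun n : ℕ => (n.descFactorial k : ℝ)) (poissonMeasure r) := fun k => by
    simpa using integrable_poisson_pow_mul_descFactorial r 0 k
  simp only [h]
  rw [integral_add (hi 2) (hi 1), integral_poisson_descFactorial, integral_poisson_descFactorial,
    pow_one]

/-! ### Path functionals and the Markov property -/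

/-- `F` only depends on the first `t + 1` coordinates `x 0, …, x t`. -/
def DependsOnPast {S : Type*} (t : ℕ) (F : (ℕ → S) → ℝ) : Prop :=
  ∀ x y : ℕ → S, (∀ s ≤ t, x s = y s) → F x = F y

theorem DependsOnPast.mono {S : Type*} {s t : ℕ} (hst : s ≤ t) {F : (ℕ → S) → ℝ}
    (hF : DependsOnPast s F) : DependsOnPast t F :=
  fun x y h => hF x y fun u hu => h u (hu.trans hst)

/-- The path that follows `h` and then stays at its last state. -/
def extendPath {S : Type*} {t : ℕ} (h : Fin (t + 1) → S) : ℕ → S :=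
  fun s => h ⟨min s t, by omega⟩

theorem extendPath_eq_iff {S : Type*} {t : ℕ} (h : Fin (t + 1) → S) (x : ℕ → S) :
    (∀ s ≤ t, x s = extendPath h s) ↔ (fun s : Fin (t + 1) => x s) = h := by
  constructor
  · intro H
    funext s
    have hs : (s : ℕ) ≤ t := by omega
    simpa [extendPath, hs] using H s hs
  · rintro rfl s hs
    simp [extendPath, hs]

theorem DependsOnPast.comp_eq {S : Type*} {t : ℕ} {F : (ℕ → S) → ℝ} (hF : DependsOnPast t F)
    (x : ℕ → S) : F x = F (extendPath fun s : Fin (t + 1) => x s) :=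
  hF _ _ ((extendPath_eq_iff _ x).2 rfl)

section Traversals

variable {S : Type*} [DecidableEq S]

/-- The number of traversals of the edge from `i` to `j` by a path before time `T`. -/
def traversals (i j : S) (T : ℕ) (x : ℕ → S) : ℕ :=
  ∑ t ∈ Finset.range T, if x t = i ∧ x (t + 1) = j then 1 else 0

theorem edgeCount_eq_traversals {Ω : Type*} (X : ℕ → Ω → S) (ℓ : ℕ) (i j : S) (ω : Ω) :
    edgeCount X ℓ i j ω = traversals i j ℓ fun s => X s ω := by
  simp [edgeCount, traversals]

theorem dependsOnPast_traversals (i j : S) (T : ℕ) (f : ℕ → ℝ) :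
    DependsOnPast T fun x => f (traversals i j T x) := by
  intro x y h
  have : traversals i j T x = traversals i j T y := by
    refine Finset.sum_congr rfl fun t ht => ?_
    rw [Finset.mem_range] at ht
    rw [h t (by omega), h (t + 1) (by omega)]
  simp only [this]

/-- Sort the `(m + 1)`-sets of traversal times by their largest element. -/
theorem choose_traversals (i j : S) (T m : ℕ) (x : ℕ → S) :
    ((traversals i j T x).choose (m + 1) : ℝ) = ∑ t ∈ Finset.range T,
      if x t = i ∧ x (t + 1) = j then ((traversals i j t x).choose m : ℝ) else 0 := by
  induction T with
  | zero => simp [traversals]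
  | succ T ih =>
    rw [Finset.sum_range_succ, ← ih, traversals, Finset.sum_range_succ, ← traversals]
    by_cases h : x T = i ∧ x (T + 1) = j
    · simp [h, Nat.choose_succ_succ, add_comm]
    · simp [h]

theorem dependsOnPast_traversalMoment (i j : S) (m T : ℕ) :
    DependsOnPast (T + 1) fun x => if x T = i ∧ x (T + 1) = j then
      ((traversals i j T x).choose m : ℝ) else 0 := by
  intro x y h
  have := (dependsOnPast_traversals i j T fun n => (n.choose m : ℝ)).mono T.le_succ x y h
  simp only [this, h T (by omega), h (T + 1) le_rfl]

end Traversals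

variable {Ω S : Type*} [MeasurableSpace Ω] [MeasurableSpace S] {μ : Measure Ω} {X : ℕ → Ω → S}
  {ℓ : ℕ} {ι : S → ℝ} {P : Matrix S S ℝ}

theorem IsSamplePath.measurable_history (hX : IsSamplePath μ X ℓ ι P) {t : ℕ} (ht : t ≤ ℓ) :
    Measurable fun ω => fun s : Fin (t + 1) => X s ω :=
  measurable_pi_lambda _ fun s => hX.measurable s (by omega)

variable [MeasurableSingletonClass S] [Fintype S] [IsProbabilityMeasure μ]

/-- Such a functional factors through the finite set of histories, so no bound is needed. -/
theorem IsSamplePath.integrable (hX : IsSamplePath μ X ℓ ι P) {t : ℕ} (ht : t ≤ ℓ)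
    {F : (ℕ → S) → ℝ} (hF : DependsOnPast t F) : Integrable (fun ω => F fun s => X s ω) μ := by
  simp only [hF.comp_eq fun s => X s _]
  have hm := hX.measurable_history ht
  have : IsProbabilityMeasure (μ.map fun ω => fun s : Fin (t + 1) => X s ω) :=
    Measure.isProbabilityMeasure_map hm.aemeasurable
  exact (Integrable.of_finite (μ := μ.map fun ω => fun s : Fin (t + 1) => X s ω)
    (f := fun h => F (extendPath h))).comp_measurable hm

theorem IsSamplePath.integral_eq_sum (hX : IsSamplePath μ X ℓ ι P) {t : ℕ} (ht : t ≤ ℓ)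
    {F : (ℕ → S) → ℝ} (hF : DependsOnPast t F) :
    ∫ ω, F (fun s => X s ω) ∂μ = ∑ h : Fin (t + 1) → S,
      F (extendPath h) * μ.real {ω | ∀ s ≤ t, X s ω = extendPath h s} := by
  simp only [hF.comp_eq fun s => X s _]
  have hm := hX.measurable_history ht
  have : IsProbabilityMeasure (μ.map fun ω => fun s : Fin (t + 1) => X s ω) :=
    Measure.isProbabilityMeasure_map hm.aemeasurable
  rw [← integral_map (f := fun h => F (extendPath h)) hm.aemeasurable
    Measurable.of_discrete.aestronglyMeasurable, integral_fintype Integrable.of_finite]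
  refine Finset.sum_congr rfl fun h _ => ?_
  rw [smul_eq_mul, mul_comm, measureReal_def, Measure.map_apply hm (measurableSet_singleton h)]
  simp only [extendPath_eq_iff h fun s => X s _]
  rfl

variable [DecidableEq S]

/-- The one-step Markov property. -/
theorem IsSamplePath.integral_step (hX : IsSamplePath μ X ℓ ι P) {t : ℕ} (ht : t < ℓ)
    {F : (ℕ → S) → ℝ} (hF : DependsOnPast t F) (y : S) :
    ∫ ω, F (fun s => X s ω) * (if X (t + 1) ω = y then 1 else 0) ∂μ =
      ∫ ω, F (fun s => X s ω) * P (X t ω) y ∂μ := by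
  rw [hX.integral_eq_sum ht.le (F := fun x => F x * P (x t) y)
    fun a b h => by simp only [hF a b h, h t le_rfl]]
  -- Only the realized history contributes, which turns the integrand into cylinder indicators to
  -- which `hX.step` applies.
  have hdec : ∀ ω, F (fun s => X s ω) * (if X (t + 1) ω = y then (1 : ℝ) else 0) =
      ∑ h : Fin (t + 1) → S, F (extendPath h) * Set.indicator {ω | ∀ s ≤ t + 1, X s ω =
        (Function.update (extendPath h) (t + 1) y) s} (fun _ => (1 : ℝ)) ω := by
    intro ω
    rw [Finset.sum_eq_single (fun s : Fin (t + 1) => X s ω)]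
    · rw [← hF.comp_eq fun s => X s ω]
      congr 1
      rw [Set.indicator_apply]
      refine if_congr ?_ rfl rfl
      constructor
      · intro h s hs
        rcases Nat.le_or_eq_of_le_succ hs with hs' | rfl
        · rw [Function.update_of_ne (by omega)]
          exact (extendPath_eq_iff _ fun s => X s ω).2 rfl s hs'
        · simpa using h
      · intro h
        simpa using h (t + 1) le_rfl
    · intro h _ hne
      rw [Set.indicator_of_notMem, mul_zero]
      intro H
      refine hne ((extendPath_eq_iff h fun s => X s ω).1 fun s hs => ?_).symm
      have := H s (by omega)
      rwa [Function.update_of_ne (by omega)] at this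
    · exact fun h => absurd (Finset.mem_univ _) h
  have hmeas : ∀ x : ℕ → S, MeasurableSet {ω | ∀ s ≤ t + 1, X s ω = x s} := by
    intro x
    simp only [Set.ofPred_forall]
    exact MeasurableSet.iInter fun s => MeasurableSet.iInter fun hs =>
      hX.measurable s (by omega) (measurableSet_singleton (x s))
  simp only [hdec]
  rw [integral_finsetSum _ fun h _ =>
    ((integrable_const (1 : ℝ)).indicator (hmeas _)).const_mul _]
  refine Finset.sum_congr rfl fun h _ => ?_
  rw [integral_const_mul, integral_indicator_const _ (hmeas _), hX.step t ht]
  have : ∀ s ≤ t, Function.update (extendPath h) (t + 1) y s = extendPath h s := fun s hs =>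
    Function.update_of_ne (by omega) _ _
  have hset : {ω | ∀ s ≤ t, X s ω = Function.update (extendPath h) (t + 1) y s} =
      {ω | ∀ s ≤ t, X s ω = extendPath h s} := by
    ext ω
    exact forall₂_congr fun s hs => by rw [this s hs]
  rw [hset, this t le_rfl, Function.update_self, smul_eq_mul]
  ring

/-- The Markov property over `g` steps. -/
theorem IsSamplePath.integral_steps (hX : IsSamplePath μ X ℓ ι P) {t : ℕ} (g : ℕ)
    (ht : t + g ≤ ℓ) {F : (ℕ → S) → ℝ} (hF : DependsOnPast t F) (y : S) :
    ∫ ω, F (fun s => X s ω) * (if X (t + g) ω = y then 1 else 0) ∂μ =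
      ∫ ω, F (fun s => X s ω) * (P ^ g) (X t ω) y ∂μ := by
  induction g generalizing y with
  | zero => simp [Matrix.one_apply]
  | succ g ih =>
    rw [← add_assoc, hX.integral_step (by omega) (hF.mono (Nat.le_add_right t g))]
    have h₁ : ∀ ω, F (fun s => X s ω) * P (X (t + g) ω) y =
        ∑ z, (F (fun s => X s ω) * (if X (t + g) ω = z then 1 else 0)) * P z y := by
      intro ω
      simp
    have h₂ : ∀ ω, F (fun s => X s ω) * (P ^ (g + 1)) (X t ω) y =
        ∑ z, (F (fun s => X s ω) * (P ^ g) (X t ω) z) * P z y := by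
      intro ω
      rw [pow_succ, Matrix.mul_apply, Finset.mul_sum]
      exact Finset.sum_congr rfl fun z _ => by ring
    simp only [h₁, h₂]
    rw [integral_finsetSum, integral_finsetSum]
    · refine Finset.sum_congr rfl fun z _ => ?_
      rw [integral_mul_const, integral_mul_const, ih (by omega)]
    · intro z _
      refine Integrable.mul_const ?_ _
      exact hX.integrable (t := t) (by omega) (F := fun x => F x * (P ^ g) (x t) z)
        fun a b h => by simp only [hF a b h, h t le_rfl]
    · intro z _
      refine Integrable.mul_const ?_ _
      exact hX.integrable (t := t + g) (by omega)
        (F := fun x => F x * (if x (t + g) = z then 1 else 0))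
        fun a b h => by simp only [hF.mono (Nat.le_add_right t g) a b h, h _ le_rfl]

theorem IsSamplePath.integral_edge (hX : IsSamplePath μ X ℓ ι P) (hι : IsEquilibrium P ι)
    {t : ℕ} (ht : t < ℓ) (i j : S) :
    ∫ ω, (if X t ω = i ∧ X (t + 1) ω = j then (1 : ℝ) else 0) ∂μ = ι i * P i j := by
  have hmarg : ∀ y, ∫ ω, (if X 0 ω = y then (1 : ℝ) else 0) ∂μ = ι y := by
    intro y
    rw [← hX.initial y, ← integral_indicator_one
      (show MeasurableSet {ω | X 0 ω = y} from
        hX.measurable 0 (Nat.zero_le _) (measurableSet_singleton y))]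
    exact integral_congr_ae (.of_forall fun ω => by simp [Set.indicator_apply])
  have hstat : ∫ ω, (if X t ω = i then (1 : ℝ) else 0) ∂μ = ι i := by
    have := hX.integral_steps (t := 0) t (by omega) (F := fun _ => 1) (fun _ _ _ => rfl) i
    simp only [zero_add, one_mul] at this
    rw [this]
    have h : ∀ ω, (P ^ t) (X 0 ω) i = ∑ x, (if X 0 ω = x then (1 : ℝ) else 0) * (P ^ t) x i := by
      intro ω
      simp
    simp only [h]
    rw [integral_finsetSum]
    · simp only [integral_mul_const, hmarg, hι.sum_mul_pow]
    · intro x _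
      exact (hX.integrable (t := 0) (Nat.zero_le _) (F := fun y => if y 0 = x then 1 else 0)
        fun a b h => by simp only [h 0 le_rfl]).mul_const _
  have := hX.integral_step ht (F := fun x => if x t = i then 1 else 0)
    (fun a b h => by simp only [h t le_rfl]) j
  rw [← hstat, ← integral_mul_const]
  refine Eq.trans (integral_congr_ae (.of_forall fun ω => ?_))
    (this.trans (integral_congr_ae (.of_forall fun ω => ?_)))
  · by_cases h : X t ω = i <;> simp [h]
  · by_cases h : X t ω = i <;> simp [h]

/-! ### Recursion for the traversal moments -/

/-- The expected number of `m`-sets of traversals before time `T` on the event that the edge is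
traversed at time `T`. -/
noncomputable def traversalMoment (μ : Measure Ω) (X : ℕ → Ω → S) (i j : S) (m T : ℕ) : ℝ :=
  ∫ ω, (if X T ω = i ∧ X (T + 1) ω = j then
    ((traversals i j T fun s => X s ω).choose m : ℝ) else 0) ∂μ

theorem IsSamplePath.traversalMoment_zero (hX : IsSamplePath μ X ℓ ι P) (hι : IsEquilibrium P ι)
    (i j : S) {T : ℕ} (hT : T < ℓ) : traversalMoment μ X i j 0 T = ι i * P i j := by
  simpa [traversalMoment] using hX.integral_edge hι hT i j

/-- A renewal equation in the last earlier traversal `t`: the path is at `j` at time `t + 1`, needs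
`T - 1 - t` steps back to `i`, then crosses again. The gap may be zero, which contributes only for
self-loops. -/
theorem IsSamplePath.traversalMoment_succ (hX : IsSamplePath μ X ℓ ι P)
    (i j : S) (m : ℕ) {T : ℕ} (hT : T < ℓ) :
    traversalMoment μ X i j (m + 1) T = ∑ t ∈ Finset.range T,
      (P ^ (T - 1 - t)) j i * P i j * traversalMoment μ X i j m t := by
  let G : ℕ → (ℕ → S) → ℝ := fun t x =>
    if x t = i ∧ x (t + 1) = j then ((traversals i j t x).choose m : ℝ) else 0
  have hG : ∀ t, DependsOnPast (t + 1) (G t) := dependsOnPast_traversalMoment i j m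
  have hdec : ∀ ω, (if X T ω = i ∧ X (T + 1) ω = j then
      ((traversals i j T fun s => X s ω).choose (m + 1) : ℝ) else 0) = ∑ t ∈ Finset.range T,
        (G t (fun s => X s ω) * (if X T ω = i then 1 else 0)) *
          (if X (T + 1) ω = j then 1 else 0) := by
    intro ω
    rw [choose_traversals, ← Finset.sum_mul, ← Finset.sum_mul]
    by_cases h₁ : X T ω = i <;> by_cases h₂ : X (T + 1) ω = j <;> simp [h₁, h₂, G]
  have hGT : ∀ t ∈ Finset.range T, DependsOnPast T fun x => G t x * (if x T = i then 1 else 0) := by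
    intro t ht x y h
    rw [Finset.mem_range] at ht
    simp only [(hG t).mono (show t + 1 ≤ T from ht) x y h, h T le_rfl]
  rw [traversalMoment]
  simp only [hdec]
  rw [integral_finsetSum]
  · refine Finset.sum_congr rfl fun t ht => ?_
    rw [hX.integral_step hT (hGT t ht)]
    rw [Finset.mem_range] at ht
    obtain ⟨g, rfl⟩ : ∃ g, T = t + 1 + g := ⟨T - (t + 1), by omega⟩
    have h₁ : ∀ ω, G t (fun s => X s ω) * (if X (t + 1 + g) ω = i then (1 : ℝ) else 0) *
        P (X (t + 1 + g) ω) j =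
        G t (fun s => X s ω) * (if X (t + 1 + g) ω = i then (1 : ℝ) else 0) * P i j := by
      intro ω
      by_cases h : X (t + 1 + g) ω = i <;> simp [h]
    have h₂ : ∀ ω, G t (fun s => X s ω) * (P ^ g) (X (t + 1) ω) i =
        G t (fun s => X s ω) * (P ^ g) j i := by
      intro ω
      by_cases h : X (t + 1) ω = j <;> simp [h, G]
    simp only [h₁]
    rw [integral_mul_const, hX.integral_steps g (by omega) (hG t)]
    simp only [h₂]
    rw [integral_mul_const, show t + 1 + g - 1 - t = g by omega, traversalMoment]
    ring
  · intro t ht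
    refine hX.integrable (t := T + 1) hT
      (F := fun x => G t x * (if x T = i then 1 else 0) * (if x (T + 1) = j then 1 else 0)) ?_
    intro x y h
    have := (hGT t ht).mono T.le_succ x y h
    simp only [this, h (T + 1) le_rfl]

theorem IsSamplePath.integral_choose_traversals (hX : IsSamplePath μ X ℓ ι P) (i j : S) (m : ℕ) :
    ∫ ω, ((traversals i j ℓ fun s => X s ω).choose (m + 1) : ℝ) ∂μ =
      ∑ t ∈ Finset.range ℓ, traversalMoment μ X i j m t := by
  simp only [choose_traversals]
  rw [integral_finsetSum]
  · rfl
  · intro t ht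
    exact hX.integrable (t := t + 1) (Finset.mem_range.1 ht) (dependsOnPast_traversalMoment i j m t)

/-! ### Convolution with a nearly constant kernel -/

/-- The error after `m` iterations of a convolution kernel at `ℓ¹`-distance `η` from a constant
kernel of total mass at most `B`. -/
def iterateError (η B : ℝ) : ℕ → ℝ
  | 0 => 0
  | m + 1 => η * (B ^ m + iterateError η B m) + B * iterateError η B m

theorem iterateError_nonneg {η B : ℝ} (hη : 0 ≤ η) (hB : 0 ≤ B) (m : ℕ) :
    0 ≤ iterateError η B m := by
  induction m with
  | zero => exact le_rfl
  | succ m ih => rw [iterateError]; positivity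

theorem tendsto_iterateError {I : Type*} {l : Filter I} {η B : I → ℝ} {b : ℝ}
    (hη : Tendsto η l (nhds 0)) (hB : Tendsto B l (nhds b)) (m : ℕ) :
    Tendsto (fun n => iterateError (η n) (B n) m) l (nhds 0) := by
  induction m with
  | zero => exact tendsto_const_nhds
  | succ m ih =>
    simp only [iterateError]
    simpa using (hη.mul ((hB.pow m).add ih)).add (hB.mul ih)

theorem sum_range_choose_eq (T m : ℕ) :
    ∑ t ∈ Finset.range T, (t.choose m : ℝ) = (T.choose (m + 1) : ℝ) := by
  induction T with
  | zero => simp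
  | succ T ih => rw [Finset.sum_range_succ, ih, Nat.choose_succ_succ]; push_cast; ring

theorem pow_mul_choose_le {q : ℝ} (hq : 0 ≤ q) {T ℓ : ℕ} (hT : T ≤ ℓ) (m : ℕ) :
    q ^ m * (T.choose m : ℝ) ≤ (q * ℓ) ^ m := by
  rw [mul_pow]
  refine mul_le_mul_of_nonneg_left ?_ (pow_nonneg hq m)
  exact_mod_cast (Nat.choose_le_pow T m).trans (Nat.pow_le_pow_left hT m)

/-- Iterated convolution of a kernel `c` that is close to the constant `q`. -/
theorem abs_iterate_sub_le {q η : ℝ} (hq : 0 ≤ q) {ℓ : ℕ} {c : ℕ → ℝ}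
    (hc : ∑ g ∈ Finset.range ℓ, |c g - q| ≤ η) {a : ℕ → ℕ → ℝ} (h0 : ∀ T < ℓ, a 0 T = q)
    (hs : ∀ m, ∀ T < ℓ, a (m + 1) T = ∑ t ∈ Finset.range T, c (T - 1 - t) * a m t)
    (m T : ℕ) (hT : T < ℓ) :
    |a m T - q * (q ^ m * (T.choose m : ℝ))| ≤ q * iterateError η (q * ℓ) m := by
  have hη : 0 ≤ η := (Finset.sum_nonneg fun _ _ => abs_nonneg _).trans hc
  have hB : 0 ≤ q * ℓ := by positivity
  induction m generalizing T with
  | zero => simp [h0 T hT, iterateError]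
  | succ m ih =>
    set d := iterateError η (q * ℓ) m
    have hd : 0 ≤ d := iterateError_nonneg hη hB m
    have hsum : ∑ t ∈ Finset.range T, |c (T - 1 - t) - q| ≤ η := by
      rw [Finset.sum_range_reflect fun g => |c g - q|]
      exact (Finset.sum_le_sum_of_subset_of_nonneg (Finset.range_mono hT.le)
        fun _ _ _ => abs_nonneg _).trans hc
    have habs : ∀ t < T, |a m t| ≤ q * ((q * ℓ) ^ m + d) := by
      intro t ht
      have h₁ := ih t (ht.trans hT)
      have h₂ := mul_le_mul_of_nonneg_left (pow_mul_choose_le hq (ht.trans hT).le m) hq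
      have h₃ : 0 ≤ q * (q ^ m * (t.choose m : ℝ)) := by positivity
      rw [abs_le] at h₁ ⊢
      constructor <;> linarith [h₁.1, h₁.2]
    -- Split the error into the kernel deviation, weighted by the crude bound `habs`, and the error
    -- inherited from level `m`.
    have hdec : a (m + 1) T - q * (q ^ (m + 1) * (T.choose (m + 1) : ℝ)) =
        ∑ t ∈ Finset.range T, ((c (T - 1 - t) - q) * a m t +
          q * (a m t - q * (q ^ m * (t.choose m : ℝ)))) := by
      rw [hs m T hT, ← sum_range_choose_eq, Finset.mul_sum, Finset.mul_sum,
        ← Finset.sum_sub_distrib]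
      exact Finset.sum_congr rfl fun t _ => by ring
    rw [hdec]
    calc |∑ t ∈ Finset.range T, ((c (T - 1 - t) - q) * a m t +
          q * (a m t - q * (q ^ m * (t.choose m : ℝ))))|
        ≤ ∑ t ∈ Finset.range T, (|c (T - 1 - t) - q| * (q * ((q * ℓ) ^ m + d)) + q * (q * d)) := by
          refine (Finset.abs_sum_le_sum_abs _ _).trans (Finset.sum_le_sum fun t ht => ?_)
          rw [Finset.mem_range] at ht
          refine (abs_add_le _ _).trans (add_le_add ?_ ?_)
          · rw [abs_mul]
            exact mul_le_mul_of_nonneg_left (habs t ht) (abs_nonneg _)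
          · rw [abs_mul, abs_of_nonneg hq]
            exact mul_le_mul_of_nonneg_left (ih t (ht.trans hT)) hq
      _ = (∑ t ∈ Finset.range T, |c (T - 1 - t) - q|) * (q * ((q * ℓ) ^ m + d)) +
            T * (q * (q * d)) := by
          rw [Finset.sum_add_distrib, Finset.sum_mul, Finset.sum_const, Finset.card_range,
            nsmul_eq_mul]
      _ ≤ η * (q * ((q * ℓ) ^ m + d)) + ℓ * (q * (q * d)) := by
          have : (T : ℝ) ≤ ℓ := by exact_mod_cast hT.le
          gcongr
      _ = q * iterateError η (q * ℓ) (m + 1) := by rw [iterateError]; ring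

/-- Each factor of the falling factorial contributes `q * (ℓ - k)`, and the correction `q * k`
vanishes in the limit. -/
theorem tendsto_pow_mul_descFactorial {I : Type*} {l : Filter I} {q : I → ℝ} {ℓ : I → ℕ} {r : ℝ}
    (hq : Tendsto q l (nhds 0)) (hr : Tendsto (fun n => q n * ℓ n) l (nhds r))
    (hℓ : Tendsto ℓ l atTop) (k : ℕ) :
    Tendsto (fun n => q n ^ k * ((ℓ n).descFactorial k : ℝ)) l (nhds (r ^ k)) := by
  induction k with
  | zero => simp [tendsto_const_nhds]
  | succ k ih =>
    have h := (hr.sub (hq.mul_const (k : ℝ))).mul ih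
    rw [zero_mul, sub_zero, ← pow_succ'] at h
    refine h.congr' ?_
    filter_upwards [hℓ.eventually_ge_atTop k] with n hn
    rw [Nat.descFactorial_succ]
    push_cast [hn]
    ring

/-! ### Poisson limits for the edge counts -/

/-- Factorial moments of the number of traversals of an edge whose expected number of traversals
converges and whose return kernel is asymptotically constant. -/
theorem tendsto_descFactorial_traversals {I : Type*} {l : Filter I} {Ω S : I → Type*}
    [∀ n, MeasurableSpace (Ω n)] [∀ n, MeasurableSpace (S n)]
    [∀ n, MeasurableSingletonClass (S n)] [∀ n, Fintype (S n)] [∀ n, DecidableEq (S n)]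
    {μ : ∀ n, Measure (Ω n)} [∀ n, IsProbabilityMeasure (μ n)] {X : ∀ n, ℕ → Ω n → S n}
    {ℓ : I → ℕ} {ι : ∀ n, S n → ℝ} {P : ∀ n, Matrix (S n) (S n) ℝ} {q : I → ℝ} {r : ℝ}
    (hX : ∀ n, IsSamplePath (μ n) (X n) (ℓ n) (ι n) (P n)) (hι : ∀ n, IsEquilibrium (P n) (ι n))
    (i j : ∀ n, S n) (hq0 : ∀ n, 0 ≤ q n) (hqeq : ∀ n, ι n (i n) * P n (i n) (j n) = q n)
    (hq : Tendsto q l (nhds 0)) (hr : Tendsto (fun n => q n * ℓ n) l (nhds r))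
    (hℓ : Tendsto ℓ l atTop)
    (hη : Tendsto (fun n => ∑ g ∈ Finset.range (ℓ n),
      |(P n ^ g) (j n) (i n) * P n (i n) (j n) - q n|) l (nhds 0)) (k : ℕ) :
    Tendsto (fun n => ∫ ω, ((traversals (i n) (j n) (ℓ n) fun s => X n s ω).descFactorial k : ℝ)
      ∂(μ n)) l (nhds (r ^ k)) := by
  rcases k with _ | m
  · simp [tendsto_const_nhds]
  refine (tendsto_pow_mul_descFactorial hq hr hℓ (m + 1)).congr_dist ?_
  have hbound := ((hr.mul (tendsto_iterateError hη hr m)).const_mul ((m + 1).factorial : ℝ))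
  rw [mul_zero, mul_zero] at hbound
  -- Summing the pointwise error over `ℓ` times costs a factor `ℓ`, absorbed by the prefactor `q`
  -- since `q * ℓ` converges.
  refine squeeze_zero (fun _ => dist_nonneg) (fun n => ?_) hbound
  have hexp : ∫ ω, ((traversals (i n) (j n) (ℓ n) fun s => X n s ω).descFactorial (m + 1) : ℝ)
      ∂(μ n) = (m + 1).factorial *
        ∑ t ∈ Finset.range (ℓ n), traversalMoment (μ n) (X n) (i n) (j n) m t := by
    rw [← (hX n).integral_choose_traversals, ← integral_const_mul]
    simp only [Nat.descFactorial_eq_factorial_mul_choose, Nat.cast_mul]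
  rw [hexp, Nat.descFactorial_eq_factorial_mul_choose, Nat.cast_mul, ← sum_range_choose_eq,
    dist_comm, Real.dist_eq]
  have : ((m + 1).factorial : ℝ) *
        ∑ t ∈ Finset.range (ℓ n), traversalMoment (μ n) (X n) (i n) (j n) m t -
      q n ^ (m + 1) * (((m + 1).factorial : ℝ) * ∑ t ∈ Finset.range (ℓ n), (t.choose m : ℝ)) =
      (m + 1).factorial * ∑ t ∈ Finset.range (ℓ n), (traversalMoment (μ n) (X n) (i n) (j n) m t -
        q n * (q n ^ m * (t.choose m : ℝ))) := by
    rw [Finset.sum_sub_distrib, ← Finset.mul_sum, ← Finset.mul_sum]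
    ring
  rw [this, abs_mul, Nat.abs_cast]
  refine mul_le_mul_of_nonneg_left ?_ (Nat.cast_nonneg _)
  calc |∑ t ∈ Finset.range (ℓ n), (traversalMoment (μ n) (X n) (i n) (j n) m t -
        q n * (q n ^ m * (t.choose m : ℝ)))|
      ≤ ∑ t ∈ Finset.range (ℓ n), q n * iterateError (∑ g ∈ Finset.range (ℓ n),
          |(P n ^ g) (j n) (i n) * P n (i n) (j n) - q n|) (q n * ℓ n) m := by
        refine (Finset.abs_sum_le_sum_abs _ _).trans (Finset.sum_le_sum fun t ht => ?_)
        refine abs_iterate_sub_le (hq0 n) le_rfl (c := fun g =>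
          (P n ^ g) (j n) (i n) * P n (i n) (j n))
          (a := fun m t => traversalMoment (μ n) (X n) (i n) (j n) m t)
          (fun T hT => ?_) (fun m T hT => ?_) m t (Finset.mem_range.1 ht)
        · exact ((hX n).traversalMoment_zero (hι n) _ _ hT).trans (hqeq n)
        · exact (hX n).traversalMoment_succ _ _ m hT
    _ = _ := by rw [Finset.sum_const, Finset.card_range, nsmul_eq_mul]; ring

/-- In the dense regime the return kernel of an edge of the block Markov chain is asymptotically
constant in `ℓ¹`. -/
theorem tendsto_sum_abs_kernel_sub {I : Type*} {l : Filter I} {C : Type*} [Fintype C]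
    [DecidableEq C] {p : Matrix C C ℝ} (hp : p ∈ Matrix.rowStochastic ℝ C) (hprim : p.IsPrimitive)
    {π : C → ℝ} (hπ : IsEquilibrium p π) {V : I → Type*} [∀ n, Fintype (V n)]
    [∀ n, DecidableEq (V n)] {σ : ∀ n, V n → C} (hσ : ∀ n, Function.Surjective (σ n))
    {k₁ k₂ : C} {ℓ : I → ℕ} {b : ℝ} (hℓ : Tendsto ℓ l atTop)
    (hs : Tendsto (fun n => (clusterSize (σ n) k₂ : ℝ)) l atTop)
    (hq : Tendsto (fun n => π k₁ * p k₁ k₂ /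
      ((clusterSize (σ n) k₁ : ℝ) * (clusterSize (σ n) k₂ : ℝ))) l (nhds 0))
    (hb : Tendsto (fun n => (ℓ n : ℝ) /
      ((clusterSize (σ n) k₁ : ℝ) * (clusterSize (σ n) k₂ : ℝ))) l (nhds b))
    (i j : ∀ n, V n) (hi : ∀ n, σ n (i n) = k₁) (hj : ∀ n, σ n (j n) = k₂) :
    Tendsto (fun n => ∑ g ∈ Finset.range (ℓ n),
      |(blockTransition p (σ n) ^ g) (j n) (i n) * blockTransition p (σ n) (i n) (j n) -
        π k₁ * p k₁ k₂ / ((clusterSize (σ n) k₁ : ℝ) * (clusterSize (σ n) k₂ : ℝ))|)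
      l (nhds 0) := by
  have hp0 : 0 ≤ p k₁ k₂ := Matrix.nonneg_of_mem_rowStochastic hp
  have hces : Tendsto (fun n => ((ℓ n : ℝ)⁻¹ * ∑ g ∈ Finset.range (ℓ n),
      |(p ^ g) k₂ k₁ - π k₁|)) l (nhds 0) := by
    have h : Tendsto (fun g => |(p ^ g) k₂ k₁ - π k₁|) atTop (nhds 0) := by
      simpa using ((tendsto_pow_of_isPrimitive hp hprim hπ k₂ k₁).sub_const (π k₁)).abs
    exact h.cesaro.comp hℓ
  have hlim := ((hs.const_div_atTop (p k₁ k₂)).add hq).add ((hb.mul hces).const_mul (p k₁ k₂))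
  rw [mul_zero, mul_zero, add_zero, add_zero] at hlim
  refine squeeze_zero' (.of_forall fun n => Finset.sum_nonneg fun _ _ => abs_nonneg _) ?_ hlim
  filter_upwards [hℓ.eventually_gt_atTop 0] with n hn
  set s₁ : ℝ := (clusterSize (σ n) k₁ : ℝ)
  set s₂ : ℝ := (clusterSize (σ n) k₂ : ℝ)
  have hs₁ : 0 < s₁ := Nat.cast_pos.2 (clusterSize_pos (hσ n) k₁)
  have hs₂ : 0 < s₂ := Nat.cast_pos.2 (clusterSize_pos (hσ n) k₂)
  have hPij : blockTransition p (σ n) (i n) (j n) = p k₁ k₂ / s₂ := by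
    simp [blockTransition, hi, hj, s₂]
  have hq0 : 0 ≤ π k₁ * p k₁ k₂ / (s₁ * s₂) :=
    div_nonneg (mul_nonneg (hπ.nonneg _) hp0) (by positivity)
  have hP0 : 0 ≤ p k₁ k₂ / s₂ := by positivity
  -- The gap zero is bounded crudely by the sum of both quantities, each tending to zero; other gaps
  -- reduce to the mixing error of `p`.
  have hterm : ∀ g, |(blockTransition p (σ n) ^ g) (j n) (i n) *
      blockTransition p (σ n) (i n) (j n) - π k₁ * p k₁ k₂ / (s₁ * s₂)| ≤
      (if g = 0 then p k₁ k₂ / s₂ + π k₁ * p k₁ k₂ / (s₁ * s₂) else 0) +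
        p k₁ k₂ / (s₁ * s₂) * |(p ^ g) k₂ k₁ - π k₁| := by
    intro g
    rw [hPij]
    rcases g with _ | g
    · have h₃ : 0 ≤ p k₁ k₂ / (s₁ * s₂) * |(p ^ 0) k₂ k₁ - π k₁| := by positivity
      have h₄ : |((blockTransition p (σ n) ^ 0) (j n) (i n)) * (p k₁ k₂ / s₂) -
          π k₁ * p k₁ k₂ / (s₁ * s₂)| ≤ p k₁ k₂ / s₂ + π k₁ * p k₁ k₂ / (s₁ * s₂) := by
        rw [pow_zero, Matrix.one_apply, abs_le]
        split_ifs <;> constructor <;> linarith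
      rw [if_pos rfl]
      linarith
    · rw [blockTransition_pow (hσ n), hi, hj, if_neg (Nat.succ_ne_zero g), zero_add]
      have : (p ^ (g + 1)) k₂ k₁ / s₁ * (p k₁ k₂ / s₂) - π k₁ * p k₁ k₂ / (s₁ * s₂) =
          p k₁ k₂ / (s₁ * s₂) * ((p ^ (g + 1)) k₂ k₁ - π k₁) := by
        field_simp
      rw [this, abs_mul, abs_of_nonneg (by positivity : 0 ≤ p k₁ k₂ / (s₁ * s₂))]
  refine (Finset.sum_le_sum fun g _ => hterm g).trans (le_of_eq ?_)
  rw [Finset.sum_add_distrib, Finset.sum_ite_eq' (Finset.range (ℓ n)) 0,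
    if_pos (Finset.mem_range.2 hn), ← Finset.mul_sum]
  have hn' : (ℓ n : ℝ) ≠ 0 := by exact_mod_cast hn.ne'
  field_simp

/-- Poisson limit for the number of traversals of an edge of the block Markov chain. -/
theorem tendsto_edgeCount {I : Type*} {l : Filter I} {N : I → ℕ} (hN : Tendsto N l atTop)
    {C : Type*} [Fintype C] [DecidableEq C] {p : Matrix C C ℝ}
    (hp : p ∈ Matrix.rowStochastic ℝ C) (hprim : p.IsPrimitive)
    {π : C → ℝ} (hπ : IsEquilibrium p π) {α : C → ℝ} (hα : ∀ k, 0 < α k)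
    {V : I → Type*} [∀ n, Fintype (V n)] [∀ n, DecidableEq (V n)] [∀ n, MeasurableSpace (V n)]
    [∀ n, MeasurableSingletonClass (V n)] {σ : ∀ n, V n → C}
    (hσ : ∀ n, Function.Surjective (σ n))
    (hsize : ∀ k, (fun n => (clusterSize (σ n) k : ℝ) - α k * (N n : ℝ)) =o[l] fun n => (N n : ℝ))
    {lam : ℝ} (hlam : 0 < lam) {ℓ : I → ℕ}
    (hℓ : (fun n => (ℓ n : ℝ) - lam * (N n : ℝ) ^ 2) =o[l] fun n => (N n : ℝ) ^ 2)
    {Ω : I → Type*} [∀ n, MeasurableSpace (Ω n)] {μ : ∀ n, Measure (Ω n)}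
    [∀ n, IsProbabilityMeasure (μ n)] {ι : ∀ n, V n → ℝ}
    (hι : ∀ n, IsEquilibrium (blockTransition p (σ n)) (ι n)) {X : ∀ n, ℕ → Ω n → V n}
    (hX : ∀ n, IsSamplePath (μ n) (X n) (ℓ n) (ι n) (blockTransition p (σ n)))
    {k₁ k₂ : C} (i j : ∀ n, V n) (hi : ∀ n, σ n (i n) = k₁) (hj : ∀ n, σ n (j n) = k₂) :
    Tendsto (fun n => variance (edgeCount (X n) (ℓ n) (i n) (j n)) (μ n)) l
      (nhds (blockRate lam π α p k₁ k₂)) ∧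
    ∀ m : ℕ, Tendsto (fun n => ∫ ω, edgeCount (X n) (ℓ n) (i n) (j n) ω ^ m ∂(μ n)) l
      (nhds (∫ y : ℕ, (y : ℝ) ^ m
        ∂(poissonMeasure (blockRate lam π α p k₁ k₂).toNNReal))) := by
  have hp0 : 0 ≤ p k₁ k₂ := Matrix.nonneg_of_mem_rowStochastic hp
  set r := blockRate lam π α p k₁ k₂ with hrdef
  have hr0 : 0 ≤ r := by
    have := hα k₁; have := hα k₂; have := hπ.nonneg k₁
    rw [hrdef, blockRate]; positivity
  have hNR : Tendsto (fun n => (N n : ℝ)) l atTop := tendsto_natCast_atTop_atTop.comp hN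
  have hne : ∀ᶠ n in l, (N n : ℝ) ≠ 0 := hNR.eventually_ne_atTop 0
  have hratio : ∀ k, Tendsto (fun n => (clusterSize (σ n) k : ℝ) / (N n : ℝ)) l
      (nhds (α k)) := by
    intro k
    have h := (hsize k).tendsto_div_nhds_zero.add_const (α k)
    rw [zero_add] at h
    refine h.congr' ?_
    filter_upwards [hne] with n hn
    field_simp
    ring
  have hratioℓ : Tendsto (fun n => (ℓ n : ℝ) / (N n : ℝ) ^ 2) l (nhds lam) := by
    have h := hℓ.tendsto_div_nhds_zero.add_const lam
    rw [zero_add] at h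
    refine h.congr' ?_
    filter_upwards [hne] with n hn
    field_simp
    ring
  have hs : ∀ k, Tendsto (fun n => (clusterSize (σ n) k : ℝ)) l atTop := by
    intro k
    refine ((hratio k).pos_mul_atTop (hα k) hNR).congr' ?_
    filter_upwards [hne] with n hn
    field_simp
  have hℓtop : Tendsto ℓ l atTop := by
    refine tendsto_natCast_atTop_iff.1 ((hratioℓ.pos_mul_atTop hlam
      ((tendsto_pow_atTop two_ne_zero).comp hNR)).congr' ?_)
    filter_upwards [hne] with n hn
    simp only [Function.comp]
    field_simp
  have hb : Tendsto (fun n => (ℓ n : ℝ) /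
      ((clusterSize (σ n) k₁ : ℝ) * (clusterSize (σ n) k₂ : ℝ))) l
      (nhds (lam / (α k₁ * α k₂))) := by
    refine (hratioℓ.div ((hratio k₁).mul (hratio k₂))
      (mul_pos (hα k₁) (hα k₂)).ne').congr' ?_
    filter_upwards [hne] with n hn
    simp only [Pi.div_apply]
    have := clusterSize_pos (hσ n) k₁
    have := clusterSize_pos (hσ n) k₂
    field_simp
  let q : I → ℝ := fun n => π k₁ * p k₁ k₂ /
    ((clusterSize (σ n) k₁ : ℝ) * (clusterSize (σ n) k₂ : ℝ))
  have hq : Tendsto q l (nhds 0) :=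
    ((hs k₁).atTop_mul_atTop₀ (hs k₂)).const_div_atTop (π k₁ * p k₁ k₂)
  have hqr : Tendsto (fun n => q n * ℓ n) l (nhds r) := by
    have h := hb.const_mul (π k₁ * p k₁ k₂)
    have hr : π k₁ * p k₁ k₂ * (lam / (α k₁ * α k₂)) = r := by
      rw [hrdef, blockRate, div_eq_mul_inv, mul_inv]; ring
    rw [hr] at h
    exact h.congr fun n => by simp only [q]; ring
  have hfact := tendsto_descFactorial_traversals hX hι i j (q := q)
    (fun n => div_nonneg (mul_nonneg (hπ.nonneg _) hp0) (by positivity))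
    (fun n => by
      rw [equilibrium_blockTransition_apply (hσ n) hp hprim hπ (hι n), hi]
      simp only [blockTransition, Matrix.of_apply, hi, hj, q]
      ring)
    hq hqr hℓtop
    (tendsto_sum_abs_kernel_sub hp hprim hπ hσ hℓtop (hs k₂) hq hb i j hi hj)
  have hint : ∀ n (f : ℕ → ℝ),
      Integrable (fun ω => f (traversals (i n) (j n) (ℓ n) fun s => X n s ω)) (μ n) :=
    fun n f => (hX n).integrable le_rfl (dependsOnPast_traversals (i n) (j n) (ℓ n) f)
  have hmom : ∀ m : ℕ, Tendsto (fun n => ∫ ω, edgeCount (X n) (ℓ n) (i n) (j n) ω ^ m ∂(μ n)) l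
      (nhds (∫ y : ℕ, (y : ℝ) ^ m ∂(poissonMeasure r.toNNReal))) := by
    intro m
    simp only [edgeCount_eq_traversals]
    refine tendsto_moment_of_tendsto_descFactorial μ
      (fun n ω => traversals (i n) (j n) (ℓ n) fun s => X n s ω) r.toNNReal hint ?_ m
    rw [Real.coe_toNNReal r hr0]
    exact hfact
  refine ⟨?_, hmom⟩
  have hmean : ∫ y : ℕ, (y : ℝ) ^ 1 ∂(poissonMeasure r.toNNReal) = r := by
    have := integral_poisson_descFactorial r.toNNReal 1
    simpa [Real.coe_toNNReal r hr0] using this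
  -- The variance limit is `(r ^ 2 + r) - r ^ 2`.
  have h := (hmom 2).sub ((hmom 1).pow 2)
  rw [hmean, integral_poisson_sq, Real.coe_toNNReal r hr0, add_sub_cancel_left] at h
  refine h.congr fun n => ?_
  have hmeas : AEStronglyMeasurable (edgeCount (X n) (ℓ n) (i n) (j n)) (μ n) := by
    have := (hint n fun x => (x : ℝ)).aestronglyMeasurable
    exact this.congr (.of_forall fun ω => (edgeCount_eq_traversals _ _ _ _ ω).symm)
  have hmem : MemLp (edgeCount (X n) (ℓ n) (i n) (j n)) 2 (μ n) := by
    refine (memLp_two_iff_integrable_sq hmeas).2 ?_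
    simp only [edgeCount_eq_traversals]
    exact hint n fun x => (x : ℝ) ^ 2
  rw [variance_eq_sub hmem]
  simp only [pow_one, Pi.pow_apply]

end BlockMarkov

/-! ### The limit along edge sequences and its uniform version -/

theorem corollary8
    (K : ℕ) (hK : 1 ≤ K)
    (p : Matrix (Fin K) (Fin K) ℝ) (hp : p ∈ Matrix.rowStochastic ℝ (Fin K))
    (hirr : p.IsIrreducible) (haper : BlockMarkov.IsAperiodic p)
    (π : Fin K → ℝ) (hπ : BlockMarkov.IsEquilibrium p π)
    (α : Fin K → ℝ) (hα : ∀ k, 0 < α k) (hαsum : ∑ k, α k = 1)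
    (σ : ∀ n : Set.Ici K, Fin (n : ℕ) → Fin K) (hσ : ∀ n, Function.Surjective (σ n))
    (hsize : ∀ k, (fun n : Set.Ici K =>
        (BlockMarkov.clusterSize (σ n) k : ℝ) - α k * ((n : ℕ) : ℝ))
      =o[atTop] fun n : Set.Ici K => ((n : ℕ) : ℝ))
    (lam : ℝ) (hlam : 0 < lam) (ℓ : Set.Ici K → ℕ)
    (hℓ : (fun n : Set.Ici K => (ℓ n : ℝ) - lam * ((n : ℕ) : ℝ) ^ 2)
      =o[atTop] fun n : Set.Ici K => ((n : ℕ) : ℝ) ^ 2)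
    (Ω : Set.Ici K → Type*) [∀ n, MeasurableSpace (Ω n)]
    (μ : ∀ n, Measure (Ω n)) [∀ n, IsProbabilityMeasure (μ n)]
    (eqDist : ∀ n : Set.Ici K, Fin (n : ℕ) → ℝ)
    (heq : ∀ n, BlockMarkov.IsEquilibrium (BlockMarkov.blockTransition p (σ n)) (eqDist n))
    (X : ∀ n : Set.Ici K, ℕ → Ω n → Fin (n : ℕ))
    (hX : ∀ n, BlockMarkov.IsSamplePath (μ n) (X n) (ℓ n) (eqDist n)
      (BlockMarkov.blockTransition p (σ n))) :
    (∀ k₁ k₂ : Fin K, 0 < p k₁ k₂ →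
      ∀ e : ∀ n : Set.Ici K, Fin (n : ℕ) × Fin (n : ℕ),
        (∀ n, σ n (e n).1 = k₁ ∧ σ n (e n).2 = k₂) →
        ((fun n : Set.Ici K =>
            variance (BlockMarkov.edgeCount (X n) (ℓ n) (e n).1 (e n).2) (μ n)
              - BlockMarkov.blockRate lam π α p k₁ k₂)
          =o[atTop] fun _ => (1 : ℝ)) ∧
        ∀ m : ℕ,
          ((fun n : Set.Ici K =>
              (∫ ω, BlockMarkov.edgeCount (X n) (ℓ n) (e n).1 (e n).2 ω ^ m ∂(μ n))
                - ∫ y : ℕ, (y : ℝ) ^ m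
                    ∂(poissonMeasure (BlockMarkov.blockRate lam π α p k₁ k₂).toNNReal))
            =o[atTop] fun _ => (1 : ℝ))) ∧
    (∀ ε : ℝ, 0 < ε → ∀ᶠ n : Set.Ici K in atTop, ∀ i j : Fin (n : ℕ),
      |variance (BlockMarkov.edgeCount (X n) (ℓ n) i j) (μ n)
        - BlockMarkov.blockRate lam π α p (σ n i) (σ n j)| ≤ ε) := by
  have hprim := BlockMarkov.isPrimitive_of_isAperiodic hirr haper
  have hN : Tendsto (fun n : Set.Ici K => (n : ℕ)) atTop atTop :=
    tendsto_comp_val_Ici_atTop.2 tendsto_id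
  have key := fun k₁ k₂ (e : ∀ n : Set.Ici K, Fin (n : ℕ) × Fin (n : ℕ))
      (he : ∀ n, σ n (e n).1 = k₁ ∧ σ n (e n).2 = k₂) =>
    BlockMarkov.tendsto_edgeCount hN hp hprim hπ hα hσ hsize hlam hℓ heq hX
      (fun n => (e n).1) (fun n => (e n).2) (fun n => (he n).1) (fun n => (he n).2)
  refine ⟨fun k₁ k₂ _ e he => ⟨?_, fun m => ?_⟩, fun ε hε => ?_⟩
  · rw [isLittleO_one_iff]
    exact tendsto_sub_nhds_zero_iff.2 (key k₁ k₂ e he).1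
  · rw [isLittleO_one_iff]
    exact tendsto_sub_nhds_zero_iff.2 ((key k₁ k₂ e he).2 m)
  · have hpair : ∀ k₁ k₂, ∀ᶠ n : Set.Ici K in atTop, ∀ i j : Fin (n : ℕ),
        σ n i = k₁ → σ n j = k₂ →
        |variance (BlockMarkov.edgeCount (X n) (ℓ n) i j) (μ n)
          - BlockMarkov.blockRate lam π α p k₁ k₂| ≤ ε := by
      intro k₁ k₂
      -- A worst edge exists because the block is finite and, by surjectivity of `σ n`, nonempty.
      -- The limit along this sequence of edges bounds the whole block.
      have hmax : ∀ n : Set.Ici K, ∃ e : Fin (n : ℕ) × Fin (n : ℕ),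
          (σ n e.1 = k₁ ∧ σ n e.2 = k₂) ∧ ∀ i j, σ n i = k₁ → σ n j = k₂ →
          |variance (BlockMarkov.edgeCount (X n) (ℓ n) i j) (μ n)
            - BlockMarkov.blockRate lam π α p k₁ k₂| ≤
          |variance (BlockMarkov.edgeCount (X n) (ℓ n) e.1 e.2) (μ n)
            - BlockMarkov.blockRate lam π α p k₁ k₂| := by
        intro n
        obtain ⟨i₀, hi₀⟩ := hσ n k₁
        obtain ⟨j₀, hj₀⟩ := hσ n k₂
        obtain ⟨e, he, hle⟩ := Set.exists_max_image
          {e : Fin (n : ℕ) × Fin (n : ℕ) | σ n e.1 = k₁ ∧ σ n e.2 = k₂}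
          (fun e => |variance (BlockMarkov.edgeCount (X n) (ℓ n) e.1 e.2) (μ n)
            - BlockMarkov.blockRate lam π α p k₁ k₂|) (Set.toFinite _) ⟨(i₀, j₀), hi₀, hj₀⟩
        exact ⟨e, he, fun i j hi hj => hle (i, j) ⟨hi, hj⟩⟩
      choose e he hle using hmax
      have hlim := (tendsto_sub_nhds_zero_iff.2 (key k₁ k₂ e he).1).abs
      rw [abs_zero] at hlim
      filter_upwards [hlim.eventually_le_const hε] with n hn i j hi hj
      exact (hle n i j hi hj).trans hn
    filter_upwards [eventually_all.2 fun k₁ => eventually_all.2 fun k₂ => hpair k₁ k₂]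
      with n hn i j
    exact hn _ _ i j rfl rfl
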